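/- **Theorem (Parabolic Poincaré inequality).** For $r>0$ let $B_r$ be the open ball of radius $r$ centred at $0$ in $\mathbb R^d$, and set $$Q_r = Q_r^+ := (-r^2,0]\times B_r, \qquad Q_r^- := (-3r^2,-2r^2)\times B_r .$$ For every dimension $d$ and every $\Lambda>0$ there is a constant $C>0$, depending only on $\Lambda$ and $d$, such that the following holds with $r=1/20$. Let $A=A(t,x)$ be a measurable field of real symmetric $d\times d$ matrices on $Q_1$ that is bounded by $\Lambda$, that is, for almost every $(t,x)\in Q_1$, $$|A(t,x)\xi\cdot\xi|\le \Lambda|\xi|^2\quad\text{for all }\xi\in\mathbb R^d$$ (for instance $0\le A\le\Lambda$; no coercivity is assumed). Let $f\ge 0$ be a weak subsolution in $Q_1$ of $$\partial_t f\le \nabla_x\cdot(A\nabla_x f),$$ that is, $f\in L^2(Q_1)$ has a weak spatial gradient $\nabla_x f\in L^2(Q_1)$, and $$-\int_{Q_1} f\,\partial_t\varphi\,\mathrm dt\,\mathrm dx\le-\int_{Q_1}A\nabla_x f\cdot\nabla_x\varphi\,\mathrm dt\,\mathrm dx$$ for all $0\le\varphi\in C_c^\infty((-1,0)\times B_1)$.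 Then $$\int_{Q_r^+}\bigl(f-\langle f\rangle_{Q_r^-}\bigr)_+\,\mathrm dt\,\mathrm dx\le C\int_{Q_1}|\nabla_x f|\,\mathrm dt\,\mathrm dx,\qquad \langle f\rangle_{Q_r^-}:=\frac1{|Q_r^-|}\int_{Q_r^-}f\,\mathrm dt\,\mathrm dx ,$$ where $u_+:=\max(u,0)$. -/

import Mathlib

open MeasureTheory Set

noncomputable section

namespace ParabolicPoincare

/-- Space-time `ℝ × ℝᵈ`, with points `z = (t, x)`; `ℝᵈ` carries its Euclidean norm and
space-time carries Lebesgue measure. -/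
abbrev SpaceTime (d : ℕ) : Type := ℝ × EuclideanSpace ℝ (Fin d)

/-- The parabolic cylinder `Q_r = (-r², 0] × B_r`. -/
def baseCylinder (d : ℕ) (r : ℝ) : Set (SpaceTime d) :=
  Ioc (-r ^ 2) 0 ×ˢ Metric.ball (0 : EuclideanSpace ℝ (Fin d)) r

/-- The past cylinder `Q_r⁻ = (-3r², -2r²) × B_r`. -/
def pastCylinder (d : ℕ) (r : ℝ) : Set (SpaceTime d) :=
  Ioo (-3 * r ^ 2) (-2 * r ^ 2) ×ˢ Metric.ball (0 : EuclideanSpace ℝ (Fin d)) r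

/-- Smooth test functions compactly supported in the open cylinder `(-r², 0) × B_r`. -/
structure IsTestFunction (d : ℕ) (r : ℝ) (φ : SpaceTime d → ℝ) : Prop where
  smooth : ContDiff ℝ (⊤ : ℕ∞) φ
  compact : HasCompactSupport φ
  support_subset :
    tsupport φ ⊆ Ioo (-r ^ 2) 0 ×ˢ Metric.ball (0 : EuclideanSpace ℝ (Fin d)) r

/-- The time derivative `∂_t φ (z)`. -/
def timeDeriv {d : ℕ} (φ : SpaceTime d → ℝ) (z : SpaceTime d) : ℝ :=
  fderiv ℝ φ z (1, 0)

/-- The spatial derivative `v · ∇_x φ (z)` in the direction `v`. -/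
def spaceDeriv {d : ℕ} (φ : SpaceTime d → ℝ) (z : SpaceTime d)
    (v : EuclideanSpace ℝ (Fin d)) : ℝ :=
  fderiv ℝ φ z (0, v)

/-- `g` is the weak spatial gradient `∇_x f` of `f` in `Q_r`. -/
def IsWeakSpaceGradient (d : ℕ) (r : ℝ) (f : SpaceTime d → ℝ)
    (g : SpaceTime d → EuclideanSpace ℝ (Fin d)) : Prop :=
  ∀ φ : SpaceTime d → ℝ, IsTestFunction d r φ → ∀ v : EuclideanSpace ℝ (Fin d),
    ∫ z in baseCylinder d r, f z * spaceDeriv φ z v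
      = -∫ z in baseCylinder d r, inner ℝ (g z) v * φ z

/-- `f`, with weak spatial gradient `g = ∇_x f`, is a weak subsolution of
`∂_t f ≤ ∇_x · (A ∇_x f)` in `Q_r`: `f` belongs to `L²_t H¹_x (Q_r)` and the inequality holds
when tested against nonnegative test functions. -/
structure IsWeakSubsolution (d : ℕ) (r : ℝ)
    (A : SpaceTime d → Matrix (Fin d) (Fin d) ℝ) (f : SpaceTime d → ℝ)
    (g : SpaceTime d → EuclideanSpace ℝ (Fin d)) : Prop where
  memLp : MemLp f 2 (volume.restrict (baseCylinder d r))
  memLp_grad : MemLp g 2 (volume.restrict (baseCylinder d r))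
  weakGradient : IsWeakSpaceGradient d r f g
  /-- `-∫ f ∂_t φ ≤ -∫ A ∇_x f · ∇_x φ`. -/
  subsolution : ∀ φ : SpaceTime d → ℝ, IsTestFunction d r φ → (∀ z, 0 ≤ φ z) →
    -∫ z in baseCylinder d r, f z * timeDeriv φ z
      ≤ -∫ z in baseCylinder d r, spaceDeriv φ z (Matrix.toEuclideanLin (A z) (g z))

/-- `A` is a measurable field of symmetric matrices on `Q_r` bounded by `Λ`, in the sense
`-Λ ≤ A ≤ Λ` of quadratic forms, almost everywhere in `Q_r`; no ellipticity is required. -/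
structure IsBoundedDiffusion (d : ℕ) (r Λ : ℝ)
    (A : SpaceTime d → Matrix (Fin d) (Fin d) ℝ) : Prop where
  measurable : ∀ i j, AEMeasurable (fun z => A z i j) (volume.restrict (baseCylinder d r))
  symm : ∀ᵐ z ∂(volume.restrict (baseCylinder d r)), (A z).IsSymm
  bound : ∀ᵐ z ∂(volume.restrict (baseCylinder d r)), ∀ ξ : EuclideanSpace ℝ (Fin d),
    |inner ℝ (Matrix.toEuclideanLin (A z) ξ) ξ| ≤ Λ * ‖ξ‖ ^ 2

end ParabolicPoincare

end

noncomputable section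

namespace ParabolicPoincare

variable {d : ℕ}

/-! Fix a Lipschitz probability density `ψ` on the small ball and let `F t` be the `ψ`-weighted
spatial mean of the solution at time `t`. For `z = (t, x)` in the base cylinder and `w = (s, y)` in
the past cylinder, `f z - f w ≤ |f z - F t| + (F t - F s) + |f w - F s|`. The outer terms are
deviations from a spatial mean, bounded in `L¹` by the gradient through integration along horizontal
segments (`lintegral_abs_mollify_sub_integral_le`). The middle term is where the equation enters:
testing with the indicator of `(s, t)` times `ψ` gives `F t - F s ≤ Lip(ψ) Λ ∫ |∇f|`
(`integral_mul_mollify_sub_le`). It is one-sided because `f` is only a subsolution, which is why the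
past mean is subtracted and only the positive part is controlled. Only `|A ξ| ≤ Λ |ξ|` is used, so
no coercivity is needed.

To make slices and segments meaningful, `f` is first mollified by a kernel that looks strictly into
the past; all bounds are independent of the mollification radius. The double integral of `(f z - f
w)₊` is then bounded by Fatou's lemma, and Jensen's inequality in `w` produces the mean over the
past cylinder. -/

instance instIsAddHaarMeasureSpaceTime : (volume : Measure (SpaceTime d)).IsAddHaarMeasure :=
  inferInstanceAs (((volume : Measure ℝ).prod
    (volume : Measure (EuclideanSpace ℝ (Fin d)))).IsAddHaarMeasure)

/-! ### Cylinders, coefficient bound, test functions -/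

lemma measurableSet_baseCylinder (r : ℝ) : MeasurableSet (baseCylinder d r) :=
  measurableSet_Ioc.prod measurableSet_ball

lemma measurableSet_pastCylinder (r : ℝ) : MeasurableSet (pastCylinder d r) :=
  measurableSet_Ioo.prod measurableSet_ball

/-- A symmetric operator whose quadratic form is bounded by `Λ` has norm at most `Λ`. -/
lemma norm_apply_le_of_isSymmetric {E : Type*} [NormedAddCommGroup E]
    [InnerProductSpace ℝ E] {T : E →ₗ[ℝ] E} (hT : T.IsSymmetric) {Λ : ℝ} (hΛ : 0 < Λ)
    (hb : ∀ ξ, |inner ℝ (T ξ) ξ| ≤ Λ * ‖ξ‖ ^ 2) (ξ : E) : ‖T ξ‖ ≤ Λ * ‖ξ‖ := by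
  -- Polarization: `4⟪Tξ, η⟫` is the quadratic form at `ξ + η` minus that at `ξ - η`, and the
  -- parallelogram law sums the two bounds.
  have key : ∀ η : E, inner ℝ (T ξ) η ≤ Λ / 2 * (‖ξ‖ ^ 2 + ‖η‖ ^ 2) := by
    intro η
    have h1 := (abs_le.1 (hb (ξ + η))).2
    have h2 := (abs_le.1 (hb (ξ - η))).1
    have h3 : inner ℝ (T η) ξ = inner ℝ (T ξ) η := by
      rw [hT η ξ, real_inner_comm]
    have h4 := parallelogram_law_with_norm ℝ ξ η
    simp only [map_add, map_sub, inner_add_left, inner_add_right, inner_sub_left,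
      inner_sub_right, h3] at h1 h2
    nlinarith
  -- With this `η` half of the left side reappears on the right and is absorbed.
  have h := key (Λ⁻¹ • T ξ)
  rw [inner_smul_right, real_inner_self_eq_norm_sq, norm_smul, Real.norm_of_nonneg
    (inv_nonneg.2 hΛ.le)] at h
  have h5 : ‖T ξ‖ ^ 2 ≤ (Λ * ‖ξ‖) ^ 2 := by
    have h6 : Λ * (2 * (Λ⁻¹ * ‖T ξ‖ ^ 2)) ≤
        Λ * (2 * (Λ / 2 * (‖ξ‖ ^ 2 + (Λ⁻¹ * ‖T ξ‖) ^ 2))) := by gcongr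
    have h7 : Λ * (2 * (Λ⁻¹ * ‖T ξ‖ ^ 2)) = 2 * ‖T ξ‖ ^ 2 := by field_simp
    have h8 : Λ * (2 * (Λ / 2 * (‖ξ‖ ^ 2 + (Λ⁻¹ * ‖T ξ‖) ^ 2))) =
        (Λ * ‖ξ‖) ^ 2 + ‖T ξ‖ ^ 2 := by field_simp
    linarith
  exact le_of_sq_le_sq h5 (by positivity)

lemma IsBoundedDiffusion.norm_apply_le {r Λ : ℝ} (hΛ : 0 < Λ)
    {A : SpaceTime d → Matrix (Fin d) (Fin d) ℝ} (hA : IsBoundedDiffusion d r Λ A) :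
    ∀ᵐ z ∂(volume.restrict (baseCylinder d r)), ∀ ξ : EuclideanSpace ℝ (Fin d),
      ‖Matrix.toEuclideanLin (A z) ξ‖ ≤ Λ * ‖ξ‖ := by
  filter_upwards [hA.symm, hA.bound] with z hs hb ξ
  refine norm_apply_le_of_isSymmetric ?_ hΛ hb ξ
  rw [Matrix.isSymmetric_toEuclideanLin_iff]
  exact Matrix.isHermitian_iff_isSymm.2 hs

/-- A smooth function vanishing outside a compact box inside the open cylinder is a test
function. -/
lemma IsTestFunction.of_box {φ : SpaceTime d → ℝ} (hφ : ContDiff ℝ (⊤ : ℕ∞) φ) {p q ρ : ℝ}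
    (hp : -1 < p) (hq : q < 0) (hρ : ρ < 1)
    (h : ∀ w, φ w ≠ 0 → w ∈ Icc p q ×ˢ Metric.closedBall (0 : EuclideanSpace ℝ (Fin d)) ρ) :
    IsTestFunction d 1 φ := by
  have hK : IsCompact (Icc p q ×ˢ Metric.closedBall (0 : EuclideanSpace ℝ (Fin d)) ρ) :=
    isCompact_Icc.prod (isCompact_closedBall _ _)
  have hsub : tsupport φ ⊆ Icc p q ×ˢ Metric.closedBall (0 : EuclideanSpace ℝ (Fin d)) ρ :=
    closure_minimal h hK.isClosed
  refine ⟨hφ, HasCompactSupport.intro hK fun x hx => ?_, hsub.trans ?_⟩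
  · by_contra h0
    exact hx (h x h0)
  · refine prod_mono (fun x hx => ?_) (Metric.closedBall_subset_ball hρ)
    constructor <;> norm_num <;> linarith [hx.1, hx.2]

/-! ### Mollification -/

/-- Space-time mollification of `f` by the kernel `k`. -/
def mollify (k f : SpaceTime d → ℝ) : SpaceTime d → ℝ :=
  convolution f k (ContinuousLinearMap.mul ℝ ℝ) volume

lemma mollify_apply (k f : SpaceTime d → ℝ) (z : SpaceTime d) :
    mollify k f z = ∫ w, f w * k (z - w) := rfl

section Mollify

variable {k f : SpaceTime d → ℝ}

lemma continuous_mollify (hk : ContDiff ℝ (⊤ : ℕ∞) k) (hkc : HasCompactSupport k)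
    (hf : Integrable f) : Continuous (mollify k f) :=
  hkc.continuous_convolution_right _ hf.locallyIntegrable hk.continuous

lemma integral_mollify (hk : ContDiff ℝ (⊤ : ℕ∞) k) (hkc : HasCompactSupport k)
    (hf : Integrable f) : ∫ z, mollify k f z = (∫ z, f z) * ∫ z, k z := by
  have := integral_convolution (μ := volume) (ν := volume) (ContinuousLinearMap.mul ℝ ℝ) hf
    (hk.continuous.integrable_of_hasCompactSupport hkc)
  exact this

lemma integrable_mollify (hk : ContDiff ℝ (⊤ : ℕ∞) k) (hkc : HasCompactSupport k)
    (hf : Integrable f) : Integrable (mollify k f) :=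
  hf.integrable_convolution _ (hk.continuous.integrable_of_hasCompactSupport hkc)

/-- The derivative falls on the kernel, so that the reflected kernel `w ↦ k (z - w)` can be used as
a test function in the weak formulation. -/
lemma hasFDerivAt_mollify (hk : ContDiff ℝ (⊤ : ℕ∞) k) (hkc : HasCompactSupport k)
    (hf : Integrable f) (z : SpaceTime d) :
    ∃ D : SpaceTime d →L[ℝ] ℝ, HasFDerivAt (mollify k f) D z ∧
      ∀ e, D e = ∫ w, f w * fderiv ℝ k (z - w) e := by
  have hk1 : ContDiff ℝ 1 k := hk.of_le (by exact_mod_cast le_top)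
  refine ⟨_, hkc.hasFDerivAt_convolution_right (ContinuousLinearMap.mul ℝ ℝ)
    hf.locallyIntegrable hk1 z, fun e => ?_⟩
  have hex : ConvolutionExists f (fderiv ℝ k)
      (ContinuousLinearMap.precompR (SpaceTime d) (ContinuousLinearMap.mul ℝ ℝ)) volume :=
    (hkc.fderiv (𝕜 := ℝ)).convolutionExists_right _ hf.locallyIntegrable
      (hk1.continuous_fderiv one_ne_zero)
  have := ContinuousLinearMap.integral_apply (hex z) e
  rw [convolution, this]
  rfl

end Mollify

/-! ### Spatial increments through the weak gradient -/

section WeakGradient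

variable {k f : SpaceTime d → ℝ} {g : SpaceTime d → EuclideanSpace ℝ (Fin d)}

lemma fderiv_comp_sub_left (hk : ContDiff ℝ (⊤ : ℕ∞) k) (z w e : SpaceTime d) :
    fderiv ℝ (fun w => k (z - w)) w e = -fderiv ℝ k (z - w) e := by
  have h1 : HasFDerivAt k (fderiv ℝ k (z - w)) (z - w) :=
    (hk.differentiable (by simp) _).hasFDerivAt
  have h2 : HasFDerivAt (fun w => z - w) (-ContinuousLinearMap.id ℝ (SpaceTime d)) w :=
    (hasFDerivAt_id w).const_sub z
  have h3 : HasFDerivAt (fun w => k (z - w)) _ w := h1.comp w h2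
  rw [h3.fderiv]
  simp

lemma integral_indicator_mul {r : ℝ} (f φ : SpaceTime d → ℝ) :
    ∫ w, (baseCylinder d r).indicator f w * φ w = ∫ w in baseCylinder d r, f w * φ w := by
  rw [← integral_indicator (measurableSet_baseCylinder r)]
  congr 1
  ext w
  by_cases hw : w ∈ baseCylinder d r <;> simp [hw]

/-- The spatial derivative of the mollified function is controlled by the mollified norm of the
weak gradient. -/
lemma abs_integral_mul_fderiv_le (hk : ContDiff ℝ (⊤ : ℕ∞) k) (hkc : HasCompactSupport k)
    (hk0 : ∀ z, 0 ≤ k z) (hg : Integrable ((baseCylinder d 1).indicator fun z => ‖g z‖))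
    (hw : IsWeakSpaceGradient d 1 f g) {z : SpaceTime d}
    (hz : IsTestFunction d 1 fun w => k (z - w)) (h : EuclideanSpace ℝ (Fin d)) :
    |∫ w, (baseCylinder d 1).indicator f w * fderiv ℝ k (z - w) (0, h)|
      ≤ ‖h‖ * mollify k ((baseCylinder d 1).indicator fun z => ‖g z‖) z := by
  -- The sign from reflecting the kernel cancels the sign of the integration by parts.
  have h1 := hw _ hz h
  simp only [spaceDeriv, fderiv_comp_sub_left hk, mul_neg, integral_neg, neg_inj] at h1
  rw [integral_indicator_mul, h1, mollify_apply, integral_indicator_mul, ← integral_const_mul,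
    ← Real.norm_eq_abs]
  have hex := hkc.convolutionExists_right (ContinuousLinearMap.mul ℝ ℝ)
    hg.locallyIntegrable hk.continuous z
  have hint : Integrable (fun w => ‖g w‖ * k (z - w)) (volume.restrict (baseCylinder d 1)) := by
    rw [← IntegrableOn, ← integrable_indicator_iff (measurableSet_baseCylinder 1)]
    refine hex.congr (ae_of_all _ fun w => ?_)
    by_cases hw : w ∈ baseCylinder d 1 <;> simp [hw]
  refine norm_integral_le_of_norm_le (hint.const_mul _) (ae_of_all _ fun w => ?_)
  rw [norm_mul, Real.norm_of_nonneg (hk0 _), ← mul_assoc]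
  refine mul_le_mul_of_nonneg_right ?_ (hk0 _)
  rw [mul_comm]
  exact norm_inner_le_norm _ _

/-- Spatial increments of the mollified function are bounded by the mollified norm of the weak
gradient along the segment. -/
lemma ofReal_abs_mollify_sub_le (hk : ContDiff ℝ (⊤ : ℕ∞) k) (hkc : HasCompactSupport k)
    (hk0 : ∀ z, 0 ≤ k z) (hf : Integrable ((baseCylinder d 1).indicator f))
    (hg : Integrable ((baseCylinder d 1).indicator fun z => ‖g z‖))
    (hw : IsWeakSpaceGradient d 1 f g) (z : SpaceTime d) (h : EuclideanSpace ℝ (Fin d))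
    (hz : ∀ θ ∈ Icc (0 : ℝ) 1, IsTestFunction d 1 fun w => k (z + θ • (0, h) - w)) :
    ENNReal.ofReal |mollify k ((baseCylinder d 1).indicator f) (z + (0, h))
        - mollify k ((baseCylinder d 1).indicator f) z| ≤
      ∫⁻ θ in Icc (0 : ℝ) 1, ENNReal.ofReal
        (‖h‖ * mollify k ((baseCylinder d 1).indicator fun z => ‖g z‖) (z + θ • (0, h))) := by
  set U := mollify k ((baseCylinder d 1).indicator f) with hU
  set V := mollify k ((baseCylinder d 1).indicator fun z => ‖g z‖) with hV
  have hVc : Continuous V := continuous_mollify hk hkc hg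
  choose D hD hDe using hasFDerivAt_mollify hk hkc hf
  have hder : ∀ θ : ℝ, HasDerivAt (fun θ : ℝ => U (z + θ • (0, h)))
      (D (z + θ • (0, h)) (0, h)) θ := by
    intro θ
    have h2 : HasDerivAt (fun θ : ℝ => z + θ • ((0, h) : SpaceTime d)) (0, h) θ := by
      simpa using ((hasDerivAt_id θ).smul_const ((0, h) : SpaceTime d)).const_add z
    exact (hD _).comp_hasDerivAt θ h2
  have hbd : ∀ θ ∈ Icc (0 : ℝ) 1,
      ‖D (z + θ • (0, h)) (0, h)‖ ≤ ‖h‖ * V (z + θ • (0, h)) := by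
    intro θ hθ
    rw [hDe, Real.norm_eq_abs]
    exact abs_integral_mul_fderiv_le hk hkc hk0 hg hw (hz θ hθ) h
  have hVθ : Continuous fun θ : ℝ => ‖h‖ * V (z + θ • (0, h)) := by fun_prop
  have hmain : ‖U (z + (1 : ℝ) • (0, h)) - U (z + (0 : ℝ) • (0, h))‖ ≤
      ∫ θ in (0 : ℝ)..1, ‖h‖ * V (z + θ • (0, h)) :=
    norm_sub_le_integral_of_norm_deriv_le_of_le (f := fun θ : ℝ => U (z + θ • (0, h)))
      zero_le_one (fun θ _ => (hder θ).continuousAt.continuousWithinAt)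
      (fun θ _ => (hder θ).differentiableAt.differentiableWithinAt)
      (ae_of_all _ fun θ hθ => (hder θ).deriv ▸ hbd θ (Ioo_subset_Icc_self hθ))
      (hVθ.intervalIntegrable _ _)
  rw [one_smul, zero_smul, add_zero, Real.norm_eq_abs] at hmain
  refine (ENNReal.ofReal_le_ofReal hmain).trans ?_
  rw [intervalIntegral.integral_of_le zero_le_one, ← integral_Icc_eq_integral_Ioc,
    ofReal_integral_eq_lintegral_ofReal hVθ.continuousOn.integrableOn_Icc]
  filter_upwards [ae_restrict_mem measurableSet_Icc] with θ hθ
  exact (norm_nonneg _).trans (hbd θ hθ)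

end WeakGradient

/-! ### The time-delayed kernel -/

section Kernel

variable (a : ContDiffBump (0 : ℝ)) (b : ContDiffBump (0 : EuclideanSpace ℝ (Fin d))) (c : ℝ)

/-- The product mollifier, delayed in time by `c`. -/
def kernel : SpaceTime d → ℝ := fun z => a.normed volume (z.1 - c) * b.normed volume z.2

lemma contDiff_kernel : ContDiff ℝ (⊤ : ℕ∞) (kernel a b c) := by
  have h1 : ContDiff ℝ (⊤ : ℕ∞) (a.normed volume) := a.contDiff_normed
  have h2 : ContDiff ℝ (⊤ : ℕ∞) (b.normed volume) := b.contDiff_normed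
  exact (h1.comp (contDiff_fst.sub contDiff_const)).mul (h2.comp contDiff_snd)

lemma kernel_nonneg (z : SpaceTime d) : 0 ≤ kernel a b c z :=
  mul_nonneg (a.nonneg_normed _) (b.nonneg_normed _)

lemma ContDiffBump.mem_ball_of_normed_ne_zero {E : Type*} [NormedAddCommGroup E]
    [NormedSpace ℝ E] [FiniteDimensional ℝ E] [MeasureSpace E] [BorelSpace E]
    [IsLocallyFiniteMeasure (volume : Measure E)] [(volume : Measure E).IsOpenPosMeasure]
    {b : ContDiffBump (0 : E)} {x : E} (h : b.normed volume x ≠ 0) : ‖x‖ < b.rOut := by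
  have : x ∈ Function.support (b.normed volume) := h
  rwa [b.support_normed_eq, mem_ball_zero_iff] at this

variable {a b c}

lemma mem_of_kernel_ne_zero {z : SpaceTime d} (h : kernel a b c z ≠ 0) :
    |z.1 - c| < a.rOut ∧ ‖z.2‖ < b.rOut :=
  ⟨ContDiffBump.mem_ball_of_normed_ne_zero (left_ne_zero_of_mul h),
    ContDiffBump.mem_ball_of_normed_ne_zero (right_ne_zero_of_mul h)⟩

variable (a b c) in
lemma hasCompactSupport_kernel : HasCompactSupport (kernel a b c) := by
  refine HasCompactSupport.intro
    ((isCompact_closedBall c a.rOut).prod (isCompact_closedBall 0 b.rOut)) fun z hz => ?_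
  by_contra h
  obtain ⟨h1, h2⟩ := mem_of_kernel_ne_zero h
  exact hz ⟨by simpa [Real.dist_eq] using h1.le, by simpa using h2.le⟩

variable (a b c) in
lemma integral_kernel : ∫ z, kernel a b c z = 1 := by
  have := integral_prod_mul (μ := (volume : Measure ℝ))
    (ν := (volume : Measure (EuclideanSpace ℝ (Fin d))))
    (fun t => a.normed volume (t - c)) (b.normed volume)
  rw [integral_sub_right_eq_self (fun t => a.normed volume t) c, a.integral_normed,
    b.integral_normed, mul_one] at this
  exact this

/-- A delay of `2 * ε` with a bump of radius `ε` sees only times between `z.1 - 3 * ε` and `z.1 -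
ε`. Hence even `z.1 = 0` is admissible, although test functions vanish near time `0`. -/
lemma isTestFunction_kernel {ε : ℝ} {z : SpaceTime d} (ha : a.rOut = ε) (hb : b.rOut = ε)
    (hε : 0 < ε) (h1 : -1 < z.1 - 3 * ε) (h2 : z.1 ≤ 0) (h3 : ‖z.2‖ + ε < 1) :
    IsTestFunction d 1 fun w => kernel a b (2 * ε) (z - w) := by
  refine IsTestFunction.of_box ((contDiff_kernel a b _).comp (contDiff_const.sub contDiff_id))
    h1 (q := z.1 - ε) (by linarith) h3 fun w hw => ?_
  obtain ⟨h4, h5⟩ := mem_of_kernel_ne_zero hw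
  rw [ha, abs_lt, Prod.fst_sub] at h4
  rw [hb, Prod.snd_sub] at h5
  refine ⟨⟨by linarith, by linarith⟩, ?_⟩
  rw [mem_closedBall_zero_iff]
  have := norm_sub_norm_le w.2 z.2
  rw [norm_sub_rev] at this
  linarith

open Filter Topology in
/-- The mollified functions converge almost everywhere. -/
lemma ae_tendsto_mollify_kernel {f : SpaceTime d → ℝ} (hf : Integrable f) {ε : ℕ → ℝ}
    (hε : Tendsto ε atTop (𝓝[>] 0)) {a : ℕ → ContDiffBump (0 : ℝ)}
    {b : ℕ → ContDiffBump (0 : EuclideanSpace ℝ (Fin d))}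
    (ha : ∀ n, (a n).rOut = ε n) (ha' : ∀ n, (a n).rOut ≤ 2 * (a n).rIn)
    (hb : ∀ n, (b n).rOut = ε n) (hb' : ∀ n, (b n).rOut ≤ 2 * (b n).rIn) :
    ∀ᵐ z, Tendsto (fun n => mollify (kernel (a n) (b n) (2 * ε n)) f z) atTop (𝓝 (f z)) := by
  -- The delay puts `z` off the centre of the averaging balls, but within twice their radius `ε n`;
  -- hence the dilation factor `2` in Lebesgue's differentiation theorem.
  filter_upwards [IsUnifLocDoublingMeasure.ae_tendsto_average_norm_sub
    (volume : Measure (SpaceTime d)) hf.locallyIntegrable 2] with z hz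
  have hpos : ∀ n, 0 < ε n := fun n => ha n ▸ (a n).rOut_pos
  have h1 := hz (fun n => (z.1 - 2 * ε n, z.2)) ε hε (Eventually.of_forall fun n => by
    simp [Prod.dist_eq, abs_of_pos (hpos n), (hpos n).le])
  -- As `rOut ≤ 2 * rIn`, each normalized bump is at most `2 ^ dim` over the volume of its ball: a
  -- factor `2` from time and `2 ^ d` from space. The sup-norm ball of space-time is the product of
  -- the two balls.
  have h2 := tendsto_integral_smul_of_tendsto_average_norm_sub (2 * 2 ^ d)
    (g := fun n w => kernel (a n) (b n) (2 * ε n) (z - w)) h1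
    (Eventually.of_forall fun n => hf.integrableOn) ?_ (Eventually.of_forall fun n w hw => ?_)
    (Eventually.of_forall fun n w => ?_)
  · refine h2.congr fun n => ?_
    rw [mollify_apply]
    simp_rw [smul_eq_mul, mul_comm]
  · have h3 : ∀ n, ∫ w, kernel (a n) (b n) (2 * ε n) (z - w) = 1 := fun n => by
      rw [integral_sub_left_eq_self (kernel (a n) (b n) (2 * ε n)) volume z, integral_kernel]
    simp only [h3]
    exact tendsto_const_nhds
  · obtain ⟨h4, h5⟩ := mem_of_kernel_ne_zero hw
    rw [← closedBall_prod_same]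
    rw [ha, Prod.fst_sub] at h4
    rw [hb, Prod.snd_sub] at h5
    refine ⟨?_, ?_⟩
    · rw [abs_lt] at h4
      rw [Metric.mem_closedBall, Real.dist_eq, abs_le]
      constructor <;> linarith
    · rw [Metric.mem_closedBall, dist_comm, dist_eq_norm]
      exact h5.le
  · rw [abs_of_nonneg (kernel_nonneg _ _ _ _), ← closedBall_prod_same, kernel]
    have e1 := (a n).normed_le_div_measure_closedBall_rOut volume 2 (ha' n) ((z - w).1 - 2 * ε n)
    have e2 := (b n).normed_le_div_measure_closedBall_rOut volume 2 (hb' n) (z - w).2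
    simp only [Module.finrank_self, pow_one, finrank_euclideanSpace, Fintype.card_fin, ha, hb]
      at e1 e2
    have e3 : volume.real (Metric.closedBall (z.1 - 2 * ε n) (ε n) ×ˢ Metric.closedBall z.2 (ε n))
        = volume.real (Metric.closedBall (0 : ℝ) (ε n)) *
          volume.real (Metric.closedBall (0 : EuclideanSpace ℝ (Fin d)) (ε n)) := by
      rw [Measure.volume_eq_prod, measureReal_prod_prod,
        Measure.addHaar_real_closedBall_center volume (z.1 - 2 * ε n),
        Measure.addHaar_real_closedBall_center volume z.2]
    rw [e3, ← div_mul_div_comm]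
    exact mul_le_mul e1 e2 ((b n).nonneg_normed _) (by positivity)

end Kernel

/-! ### One-sided control in time from the equation -/

section TimeRegularity

variable {a : ContDiffBump (0 : ℝ)} {b : ContDiffBump (0 : EuclideanSpace ℝ (Fin d))}

/-- A primitive of the normalized bump. -/
def bumpPrimitive (a : ContDiffBump (0 : ℝ)) (u : ℝ) : ℝ := ∫ x in (0 : ℝ)..u, a.normed volume x

lemma hasDerivAt_bumpPrimitive (u : ℝ) :
    HasDerivAt (bumpPrimitive a) (a.normed volume u) u :=
  (a.continuous_normed).integral_hasStrictDerivAt 0 u |>.hasDerivAt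

lemma contDiff_bumpPrimitive : ContDiff ℝ (⊤ : ℕ∞) (bumpPrimitive a) := by
  rw [contDiff_infty_iff_deriv]
  refine ⟨fun u => (hasDerivAt_bumpPrimitive u).differentiableAt, ?_⟩
  have : deriv (bumpPrimitive a) = a.normed volume :=
    funext fun u => (hasDerivAt_bumpPrimitive u).deriv
  rw [this]
  exact a.contDiff_normed

lemma bumpPrimitive_sub (u v : ℝ) :
    bumpPrimitive a v - bumpPrimitive a u = ∫ x in u..v, a.normed volume x :=
  intervalIntegral.integral_interval_sub_left (a.continuous_normed.intervalIntegrable _ _)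
    (a.continuous_normed.intervalIntegrable _ _)

lemma bumpPrimitive_sub_nonneg {u v : ℝ} (h : u ≤ v) :
    0 ≤ bumpPrimitive a v - bumpPrimitive a u := by
  rw [bumpPrimitive_sub]
  exact intervalIntegral.integral_nonneg h fun x _ => a.nonneg_normed x

lemma bumpPrimitive_sub_le_one {u v : ℝ} (h : u ≤ v) :
    bumpPrimitive a v - bumpPrimitive a u ≤ 1 := by
  rw [bumpPrimitive_sub, intervalIntegral.integral_of_le h, ← a.integral_normed (μ := volume)]
  exact setIntegral_le_integral a.integrable_normed (ae_of_all _ fun x => a.nonneg_normed x)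

/-- The interval misses the support of the bump. This gives the time factor of the test function its
compact support. -/
lemma bumpPrimitive_sub_eq_zero {u v : ℝ} (huv : u ≤ v)
    (h : v ≤ -a.rOut ∨ a.rOut ≤ u) : bumpPrimitive a v - bumpPrimitive a u = 0 := by
  rw [bumpPrimitive_sub]
  refine intervalIntegral.integral_zero_ae (ae_of_all _ fun x hx => ?_)
  rw [uIoc_of_le huv] at hx
  by_contra h0
  have := abs_lt.1 (ContDiffBump.mem_ball_of_normed_ne_zero h0)
  rcases h with h | h
  · linarith [hx.2, this.1]
  · linarith [hx.1, this.2]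

/-- Spatial mollification of the weight `ψ`. -/
def smoothWeight (b : ContDiffBump (0 : EuclideanSpace ℝ (Fin d)))
    (ψ : EuclideanSpace ℝ (Fin d) → ℝ) (y : EuclideanSpace ℝ (Fin d)) : ℝ :=
  ∫ v, ψ v * b.normed volume (v - y)

variable {ψ : EuclideanSpace ℝ (Fin d) → ℝ}

lemma contDiff_smoothWeight (hψ : Integrable ψ) :
    ContDiff ℝ (⊤ : ℕ∞) (smoothWeight b ψ) := by
  have h := (b.hasCompactSupport_normed (μ := volume)).contDiff_convolution_right
    (ContinuousLinearMap.mul ℝ ℝ) hψ.locallyIntegrable (b.contDiff_normed (n := (⊤ : ℕ∞)))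
  convert h using 1
  ext y
  refine integral_congr_ae (ae_of_all _ fun v => ?_)
  simp [← b.normed_neg (v - y)]

lemma smoothWeight_nonneg (hψ : ∀ v, 0 ≤ ψ v) (y : EuclideanSpace ℝ (Fin d)) :
    0 ≤ smoothWeight b ψ y :=
  integral_nonneg fun v => mul_nonneg (hψ v) (b.nonneg_normed _)

lemma norm_le_of_smoothWeight_ne_zero {ρ : ℝ} (hψ : ∀ v, ψ v ≠ 0 → ‖v‖ ≤ ρ)
    {y : EuclideanSpace ℝ (Fin d)} (hy : smoothWeight b ψ y ≠ 0) : ‖y‖ ≤ ρ + b.rOut := by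
  by_contra! h
  refine hy (integral_eq_zero_of_ae (ae_of_all _ fun v => ?_))
  by_contra h0
  have h1 := hψ v (left_ne_zero_of_mul h0)
  have h2 := ContDiffBump.mem_ball_of_normed_ne_zero (right_ne_zero_of_mul h0)
  have := norm_sub_norm_le y v
  rw [norm_sub_rev] at this
  linarith

/-- An average of translates keeps the Lipschitz constant, so the final bound does not depend on the
radius of `b`. -/
lemma lipschitzWith_smoothWeight {L : NNReal} (hψ : LipschitzWith L ψ) :
    LipschitzWith L (smoothWeight b ψ) := by
  have key : ∀ y, smoothWeight b ψ y = ∫ u, ψ (u + y) * b.normed volume u := fun y => by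
    rw [smoothWeight, ← integral_add_right_eq_self _ y]
    simp
  have hint : ∀ y, Integrable fun u => ψ (u + y) * b.normed volume u := fun y =>
    ((hψ.continuous.comp (continuous_id.add continuous_const)).mul
      b.continuous_normed).integrable_of_hasCompactSupport b.hasCompactSupport_normed.mul_left
  refine LipschitzWith.of_dist_le_mul fun x y => ?_
  rw [dist_eq_norm, key, key, ← integral_sub (hint x) (hint y)]
  have h1 : ∫ u, L * dist x y * b.normed volume u = L * dist x y := by
    rw [integral_const_mul, b.integral_normed, mul_one]
  rw [← h1]
  refine norm_integral_le_of_norm_le (b.integrable_normed.const_mul _) (ae_of_all _ fun u => ?_)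
  rw [← sub_mul, norm_mul, Real.norm_of_nonneg (b.nonneg_normed u)]
  refine mul_le_mul_of_nonneg_right ?_ (b.nonneg_normed u)
  have := hψ.dist_le_mul (u + x) (u + y)
  rwa [dist_add_left, dist_eq_norm] at this

/-- Fubini for the weighted spatial average of a mollified function. -/
lemma integral_mul_mollify {f : SpaceTime d → ℝ} (hf : Integrable f) (hψ : Integrable ψ) (c t : ℝ) :
    ∫ v, ψ v * mollify (kernel a b c) f (t, v)
      = ∫ w, f w * (a.normed volume (t - w.1 - c) * smoothWeight b ψ w.2) := by
  have hkc := hasCompactSupport_kernel a b c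
  have hk := (contDiff_kernel a b c).continuous
  simp_rw [mollify_apply, ← integral_const_mul]
  rw [integral_integral_swap]
  · refine integral_congr_ae (ae_of_all _ fun w => ?_)
    simp only [smoothWeight, ← integral_const_mul]
    refine integral_congr_ae (ae_of_all _ fun v => ?_)
    simp only [kernel, Prod.fst_sub, Prod.snd_sub]
    ring
  · obtain ⟨C, hC⟩ := hkc.exists_bound_of_continuous hk
    have h1 : Integrable (fun p : EuclideanSpace ℝ (Fin d) × SpaceTime d =>
        kernel a b c ((t, p.1) - p.2) * (ψ p.1 * f p.2)) (volume.prod volume) := by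
      refine (hψ.mul_prod hf).bdd_mul (c := C) ?_ (ae_of_all _ fun p => hC _)
      exact (hk.comp (by fun_prop)).aestronglyMeasurable
    refine h1.congr (ae_of_all _ fun p => ?_)
    simp only [Function.uncurry]
    ring

/-- Weighted spatial averages of a subsolution increase in time by at most a multiple of the total
variation. -/
lemma integral_mul_mollify_sub_le {Λ : ℝ} (hΛ : 0 < Λ)
    {A : SpaceTime d → Matrix (Fin d) (Fin d) ℝ} (hA : IsBoundedDiffusion d 1 Λ A)
    {f : SpaceTime d → ℝ} {g : SpaceTime d → EuclideanSpace ℝ (Fin d)}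
    (hsub : IsWeakSubsolution d 1 A f g) (hf : Integrable ((baseCylinder d 1).indicator f))
    (hg : IntegrableOn g (baseCylinder d 1))
    {L : NNReal} (hψ : LipschitzWith L ψ) (hψ0 : ∀ v, 0 ≤ ψ v) {ρ : ℝ}
    (hψρ : ∀ v, ψ v ≠ 0 → ‖v‖ ≤ ρ) {ε : ℝ} (ha : a.rOut = ε) (hb : b.rOut = ε)
    (hρ : ρ + ε < 1) {s t : ℝ} (hst : s ≤ t) (hs : -1 < s - 3 * ε) (ht : t ≤ 0) :
    (∫ v, ψ v * mollify (kernel a b (2 * ε)) ((baseCylinder d 1).indicator f) (t, v))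
      - ∫ v, ψ v * mollify (kernel a b (2 * ε)) ((baseCylinder d 1).indicator f) (s, v)
      ≤ L * Λ * ∫ w in baseCylinder d 1, ‖g w‖ := by
  have hε : 0 < ε := ha ▸ a.rOut_pos
  have hψs : HasCompactSupport ψ :=
    HasCompactSupport.intro (isCompact_closedBall (0 : EuclideanSpace ℝ (Fin d)) ρ) fun v hv => by
      by_contra h
      exact hv (by simpa using hψρ v h)
  have hψi : Integrable ψ := hψ.continuous.integrable_of_hasCompactSupport hψs
  set χ := smoothWeight b ψ with hχ
  have hχd : ContDiff ℝ (⊤ : ℕ∞) χ := contDiff_smoothWeight hψi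
  -- A smoothed indicator of `(s, t)`, shifted back by the delay; its derivative is the time factor
  -- of the kernel for `s` minus that for `t`.
  set α : ℝ → ℝ := fun τ => bumpPrimitive a (t - τ - 2 * ε) - bumpPrimitive a (s - τ - 2 * ε)
    with hα
  have hαd : ContDiff ℝ (⊤ : ℕ∞) α :=
    (contDiff_bumpPrimitive.comp ((contDiff_const.sub contDiff_id).sub contDiff_const)).sub
      (contDiff_bumpPrimitive.comp ((contDiff_const.sub contDiff_id).sub contDiff_const))
  have hle : ∀ τ, s - τ - 2 * ε ≤ t - τ - 2 * ε := fun τ => by linarith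
  have hα0 : ∀ τ, 0 ≤ α τ := fun τ => bumpPrimitive_sub_nonneg (hle τ)
  have hα1 : ∀ τ, α τ ≤ 1 := fun τ => bumpPrimitive_sub_le_one (hle τ)
  have hα' : ∀ τ, HasDerivAt α
      (-(a.normed volume (t - τ - 2 * ε) - a.normed volume (s - τ - 2 * ε))) τ := by
    intro τ
    have e : ∀ r : ℝ, HasDerivAt (fun τ => r - τ - 2 * ε) (-1) τ := fun r =>
      ((hasDerivAt_id τ).const_sub r).sub_const _
    have := ((hasDerivAt_bumpPrimitive (a := a) _).comp τ (e t)).sub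
      ((hasDerivAt_bumpPrimitive (a := a) _).comp τ (e s))
    refine this.congr_deriv ?_
    ring
  set φ : SpaceTime d → ℝ := fun w => α w.1 * χ w.2 with hφ
  have hφt : IsTestFunction d 1 φ := by
    refine IsTestFunction.of_box ((hαd.comp contDiff_fst).mul (hχd.comp contDiff_snd)) hs
      (q := t - ε) (by linarith) hρ fun w hw => ⟨⟨?_, ?_⟩, ?_⟩
    · by_contra! h
      exact left_ne_zero_of_mul hw (bumpPrimitive_sub_eq_zero (hle _) (Or.inr (by linarith)))
    · by_contra! h
      exact left_ne_zero_of_mul hw (bumpPrimitive_sub_eq_zero (hle _) (Or.inl (by linarith)))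
    · rw [mem_closedBall_zero_iff, ← hb]
      exact norm_le_of_smoothWeight_ne_zero hψρ (right_ne_zero_of_mul hw)
  have hφ' : ∀ w e, fderiv ℝ φ w e = α w.1 * fderiv ℝ χ w.2 e.2 +
      χ w.2 * (e.1 * -(a.normed volume (t - w.1 - 2 * ε) - a.normed volume (s - w.1 - 2 * ε))) := by
    intro w e
    have h1 : HasFDerivAt (fun w : SpaceTime d => α w.1) _ w :=
      (hα' w.1).hasFDerivAt.comp w hasFDerivAt_fst
    have h2 : HasFDerivAt (fun w : SpaceTime d => χ w.2) _ w :=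
      ((hχd.differentiable (by simp)) w.2).hasFDerivAt.comp w hasFDerivAt_snd
    have h3 : HasFDerivAt φ _ w := h1.mul h2
    rw [h3.fderiv]
    simp
  have main := hsub.subsolution φ hφt fun w => mul_nonneg (hα0 _) (smoothWeight_nonneg hψ0 _)
  -- By Fubini, the time derivative of this `φ` turns the left side of the weak inequality into
  -- exactly the increment of the weighted mean.
  have hlhs : -∫ z in baseCylinder d 1, f z * timeDeriv φ z =
      (∫ v, ψ v * mollify (kernel a b (2 * ε)) ((baseCylinder d 1).indicator f) (t, v))
      - ∫ v, ψ v * mollify (kernel a b (2 * ε)) ((baseCylinder d 1).indicator f) (s, v) := by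
    have hint : ∀ r, Integrable fun w : SpaceTime d => (baseCylinder d 1).indicator f w *
        (a.normed volume (r - w.1 - 2 * ε) * χ w.2) := by
      intro r
      have hcont : Continuous fun w : SpaceTime d => a.normed volume (r - w.1 - 2 * ε) * χ w.2 :=
        (a.continuous_normed.comp (by fun_prop)).mul (hχd.continuous.comp continuous_snd)
      have hcs : HasCompactSupport fun w : SpaceTime d =>
          a.normed volume (r - w.1 - 2 * ε) * χ w.2 := by
        refine HasCompactSupport.intro ((isCompact_closedBall (r - 2 * ε) ε).prod
          (isCompact_closedBall (0 : EuclideanSpace ℝ (Fin d)) (ρ + ε))) fun w hw => ?_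
        by_contra h
        refine hw ⟨?_, ?_⟩
        · have := ContDiffBump.mem_ball_of_normed_ne_zero (left_ne_zero_of_mul h)
          rw [ha, Real.norm_eq_abs, abs_lt] at this
          rw [Metric.mem_closedBall, Real.dist_eq, abs_le]
          constructor <;> linarith
        · rw [mem_closedBall_zero_iff, ← hb]
          exact norm_le_of_smoothWeight_ne_zero hψρ (right_ne_zero_of_mul h)
      obtain ⟨C, hC⟩ := hcs.exists_bound_of_continuous hcont
      exact hf.mul_bdd hcont.aestronglyMeasurable (ae_of_all _ hC)
    rw [integral_mul_mollify hf hψi, integral_mul_mollify hf hψi,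
      ← integral_sub (hint t) (hint s), ← integral_indicator_mul, ← integral_neg]
    refine integral_congr_ae (ae_of_all _ fun w => ?_)
    simp only [timeDeriv, hφ', map_zero]
    ring
  rw [← hlhs]
  refine main.trans ((neg_le_abs _).trans ?_)
  rw [← Real.norm_eq_abs, ← integral_const_mul]
  refine norm_integral_le_of_norm_le (hg.norm.const_mul _) ?_
  filter_upwards [hA.norm_apply_le hΛ] with w hw
  rw [spaceDeriv, hφ']
  simp only [zero_mul, mul_zero, add_zero, norm_mul, Real.norm_of_nonneg (hα0 _)]
  have h1 : ‖fderiv ℝ χ w.2‖ ≤ L :=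
    norm_fderiv_le_of_lipschitz ℝ (lipschitzWith_smoothWeight hψ)
  calc α w.1 * ‖fderiv ℝ χ w.2 (Matrix.toEuclideanLin (A w) (g w))‖
      ≤ 1 * (‖fderiv ℝ χ w.2‖ * ‖Matrix.toEuclideanLin (A w) (g w)‖) :=
        mul_le_mul (hα1 _) (ContinuousLinearMap.le_opNorm _ _) (norm_nonneg _) zero_le_one
    _ ≤ 1 * (L * (Λ * ‖g w‖)) := by
        gcongr
        exact hw _
    _ = L * Λ * ‖g w‖ := by ring

end TimeRegularity

/-! ### Positive parts, Jensen and Fatou -/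

lemma ofReal_integral_le_lintegral {α : Type*} [MeasurableSpace α] {μ : Measure α} {f : α → ℝ}
    (hf : Integrable f μ) : ENNReal.ofReal (∫ x, f x ∂μ) ≤ ∫⁻ x, ENNReal.ofReal (f x) ∂μ := by
  calc ENNReal.ofReal (∫ x, f x ∂μ) ≤ ENNReal.ofReal (∫ x, max (f x) 0 ∂μ) :=
        ENNReal.ofReal_le_ofReal (integral_mono hf hf.pos_part fun x => le_max_left _ _)
    _ = ∫⁻ x, ENNReal.ofReal (max (f x) 0) ∂μ :=
        ofReal_integral_eq_lintegral_ofReal hf.pos_part (ae_of_all _ fun x => le_max_right _ _)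
    _ = ∫⁻ x, ENNReal.ofReal (f x) ∂μ := by simp

/-- Jensen's inequality for the positive part. -/
lemma ofReal_sub_average_mul_le {α : Type*} [MeasurableSpace α] {μ : Measure α}
    [IsFiniteMeasure μ] [NeZero μ] {f : α → ℝ} (hf : Integrable f μ) (x : ℝ) :
    ENNReal.ofReal (x - ⨍ w, f w ∂μ) * μ univ ≤ ∫⁻ w, ENNReal.ofReal (x - f w) ∂μ := by
  refine le_trans (le_of_eq ?_) (ofReal_integral_le_lintegral ((integrable_const x).sub hf))
  have h : (∫ w, (x - f w) ∂μ) = (x - ⨍ w, f w ∂μ) * μ.real univ := by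
    rw [integral_sub (integrable_const x) hf, integral_const, smul_eq_mul, average_eq, smul_eq_mul]
    have : μ.real univ ≠ 0 := by simp [measureReal_eq_zero_iff, NeZero.ne μ]
    field_simp
  rw [h, ENNReal.ofReal_mul' measureReal_nonneg, ofReal_measureReal]

open Filter Topology in
/-- Fatou's lemma for the oscillation functional. -/
lemma lintegral_lintegral_ofReal_sub_le_of_tendsto {α : Type*} [MeasurableSpace α]
    {μ ν : Measure α} [SFinite ν] {U : ℕ → α → ℝ} {f : α → ℝ} (hU : ∀ n, Measurable (U n))
    (hμ : ∀ᵐ z ∂μ, Tendsto (fun n => U n z) atTop (𝓝 (f z)))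
    (hν : ∀ᵐ z ∂ν, Tendsto (fun n => U n z) atTop (𝓝 (f z))) {B : ENNReal}
    (hB : ∀ n, ∫⁻ z, ∫⁻ w, ENNReal.ofReal (U n z - U n w) ∂ν ∂μ ≤ B) :
    ∫⁻ z, ∫⁻ w, ENNReal.ofReal (f z - f w) ∂ν ∂μ ≤ B := by
  have hm : ∀ n, Measurable fun p : α × α => ENNReal.ofReal (U n p.1 - U n p.2) := fun n =>
    (((hU n).comp measurable_fst).sub ((hU n).comp measurable_snd)).ennreal_ofReal
  calc ∫⁻ z, ∫⁻ w, ENNReal.ofReal (f z - f w) ∂ν ∂μ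
      ≤ ∫⁻ z, liminf (fun n => ∫⁻ w, ENNReal.ofReal (U n z - U n w) ∂ν) atTop ∂μ := by
        refine lintegral_mono_ae ?_
        filter_upwards [hμ] with z hz
        refine le_trans (lintegral_mono_ae ?_) (lintegral_liminf_le fun n =>
          (hm n).comp measurable_prodMk_left)
        filter_upwards [hν] with w hw
        exact ((ENNReal.continuous_ofReal.tendsto _).comp (hz.sub hw)).liminf_eq.ge
    _ ≤ liminf (fun n => ∫⁻ z, ∫⁻ w, ENNReal.ofReal (U n z - U n w) ∂ν ∂μ) atTop :=
        lintegral_liminf_le fun n => (hm n).lintegral_prod_right'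
    _ ≤ B := liminf_le_of_le (by isBoundedDefault) fun b hb => by
        obtain ⟨n, hn⟩ := hb.exists
        exact hn.trans (hB n)

/-! ### Spatial Poincaré inequality on time slices -/

section Slices

variable {a : ContDiffBump (0 : ℝ)} {b : ContDiffBump (0 : EuclideanSpace ℝ (Fin d))}
  {f : SpaceTime d → ℝ} {g : SpaceTime d → EuclideanSpace ℝ (Fin d)}
  {ψ : EuclideanSpace ℝ (Fin d) → ℝ}

/-- Averaging over all small spatial shifts. -/
lemma lintegral_shift_eq {V : SpaceTime d → ENNReal} (hV : Measurable V)
    (B : Set (EuclideanSpace ℝ (Fin d))) :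
    ∫⁻ z, ∫⁻ h in B, ∫⁻ θ in Icc (0 : ℝ) 1, V (z + θ • (0, h)) = volume B * ∫⁻ z, V z := by
  have hm : Measurable fun p : (SpaceTime d × EuclideanSpace ℝ (Fin d)) × ℝ =>
      V (p.1.1 + p.2 • (0, p.1.2)) := hV.comp (by fun_prop)
  rw [lintegral_lintegral_swap]
  · have : ∀ h : EuclideanSpace ℝ (Fin d),
        ∫⁻ z, ∫⁻ θ in Icc (0 : ℝ) 1, V (z + θ • (0, h)) = ∫⁻ z, V z := by
      intro h
      -- For fixed `h` and `θ` the shift preserves the integral over all of space-time.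
      rw [lintegral_lintegral_swap]
      · simp_rw [lintegral_add_right_eq_self V]
        simp
      · exact (hV.comp (by fun_prop)).aemeasurable
    simp only [this, lintegral_const, Measure.restrict_apply_univ, mul_comm]
  · exact hm.lintegral_prod_right'.aemeasurable

/-- The deviation of the mollified function from its weighted spatial averages is controlled by
the gradient. -/
lemma lintegral_abs_mollify_sub_integral_le
    (hf : Integrable ((baseCylinder d 1).indicator f)) (hg : IntegrableOn g (baseCylinder d 1))
    (hw : IsWeakSpaceGradient d 1 f g) (hψc : Continuous ψ) (hψ0 : ∀ v, 0 ≤ ψ v)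
    {r : ℝ} (hr : 0 < r) (hψr : ∀ v, ψ v ≠ 0 → ‖v‖ < r) (hψ1 : ∫ v, ψ v = 1) {M : ℝ}
    (hM : ∀ v, ψ v ≤ M) {ε : ℝ} (ha : a.rOut = ε) (hb : b.rOut = ε) (hrε : r + ε < 1)
    {S : Set (SpaceTime d)} (hS : MeasurableSet S)
    (hSr : ∀ z ∈ S, -1 < z.1 - 3 * ε ∧ z.1 ≤ 0 ∧ ‖z.2‖ < r) :
    ∫⁻ z in S, ENNReal.ofReal |mollify (kernel a b (2 * ε)) ((baseCylinder d 1).indicator f) z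
        - ∫ v, ψ v * mollify (kernel a b (2 * ε)) ((baseCylinder d 1).indicator f) (z.1, v)|
      ≤ ENNReal.ofReal (M * (2 * r) *
          volume.real (Metric.ball (0 : EuclideanSpace ℝ (Fin d)) (2 * r)) *
          ∫ w in baseCylinder d 1, ‖g w‖) := by
  have hε : 0 < ε := ha ▸ a.rOut_pos
  have hk := contDiff_kernel a b (2 * ε)
  have hkc := hasCompactSupport_kernel a b (2 * ε)
  have hG : Integrable ((baseCylinder d 1).indicator fun z => ‖g z‖) :=
    (integrable_indicator_iff (measurableSet_baseCylinder 1)).2 hg.norm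
  have hM0 : 0 ≤ M := (hψ0 0).trans (hM 0)
  set U := mollify (kernel a b (2 * ε)) ((baseCylinder d 1).indicator f) with hU
  set V := mollify (kernel a b (2 * ε)) ((baseCylinder d 1).indicator fun z => ‖g z‖) with hV
  have hUc : Continuous U := continuous_mollify hk hkc hf
  have hVc : Continuous V := continuous_mollify hk hkc hG
  have hV0 : ∀ z, 0 ≤ V z := fun z => integral_nonneg fun w =>
    mul_nonneg (indicator_nonneg (fun _ _ => norm_nonneg _) _) (kernel_nonneg _ _ _ _)
  have hψs : HasCompactSupport ψ :=
    HasCompactSupport.intro (isCompact_closedBall (0 : EuclideanSpace ℝ (Fin d)) r) fun v hv => by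
      by_contra h
      exact hv (by simpa using (hψr v h).le)
  set Φ : SpaceTime d → ENNReal := fun z => ENNReal.ofReal (M * (2 * r) * V z) with hΦ
  have hΦm : Measurable Φ := (hVc.measurable.const_mul _).ennreal_ofReal
  set B := Metric.ball (0 : EuclideanSpace ℝ (Fin d)) (2 * r) with hB
  have hpt : ∀ z ∈ S, ENNReal.ofReal |U z - ∫ v, ψ v * U (z.1, v)| ≤
      ∫⁻ h in B, ∫⁻ θ in Icc (0 : ℝ) 1, Φ (z + θ • (0, h)) := by
    intro z hz
    obtain ⟨hz1, hz2, hz3⟩ := hSr z hz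
    have hUz : Continuous fun v => U (z.1, v) := hUc.comp (by fun_prop)
    have e1 : U z - ∫ v, ψ v * U (z.1, v) = ∫ v, ψ v * (U z - U (z.1, v)) := by
      simp_rw [mul_sub]
      rw [integral_sub ((hψc.integrable_of_hasCompactSupport hψs).mul_const _)
        (Continuous.integrable_of_hasCompactSupport (f := fun v => ψ v * U (z.1, v))
          (hψc.mul hUz) hψs.mul_right), integral_mul_const, hψ1,
        one_mul]
    have e2 : |∫ v, ψ v * (U z - U (z.1, v))| ≤ ∫ v, ψ v * |U z - U (z.1, v)| := by
      refine (abs_integral_le_integral_abs).trans (le_of_eq ?_)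
      simp_rw [abs_mul, abs_of_nonneg (hψ0 _)]
    have e3 : Integrable fun v => ψ v * |U z - U (z.1, v)| :=
      (hψc.mul (continuous_const.sub hUz).abs).integrable_of_hasCompactSupport hψs.mul_right
    -- Substituting `h = v - z.2` replaces the `z`-dependent set of displacements by the fixed ball
    -- `B`, which allows the integrals over `z` and `h` to be exchanged later.
    have e4 : ∫⁻ h in B, ∫⁻ θ in Icc (0 : ℝ) 1, Φ (z + θ • (0, h)) =
        ∫⁻ v, B.indicator (fun h => ∫⁻ θ in Icc (0 : ℝ) 1, Φ (z + θ • (0, h))) (v - z.2) := by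
      rw [lintegral_sub_right_eq_self
        (B.indicator fun h => ∫⁻ θ in Icc (0 : ℝ) 1, Φ (z + θ • (0, h))),
        lintegral_indicator measurableSet_ball]
    rw [e1, e4]
    refine (ENNReal.ofReal_le_ofReal e2).trans
      ((ofReal_integral_le_lintegral e3).trans (lintegral_mono fun v => ?_))
    by_cases hv : ψ v = 0
    · simp [hv]
    have hvr := hψr v hv
    have hvz : ‖v - z.2‖ < 2 * r := by
      have := norm_sub_le v z.2
      linarith
    rw [indicator_of_mem (by simpa [hB] using hvz)]
    have htest : ∀ θ ∈ Icc (0 : ℝ) 1,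
        IsTestFunction d 1 fun w => kernel a b (2 * ε) (z + θ • (0, v - z.2) - w) := by
      intro θ hθ
      refine isTestFunction_kernel ha hb hε (by simpa using hz1) (by simpa using hz2) ?_
      -- The segment joins two points of the ball of radius `r`, so by convexity it stays there.
      have : (z + θ • ((0, v - z.2) : SpaceTime d)).2 = (1 - θ) • z.2 + θ • v := by
        simp only [Prod.snd_add, Prod.smul_snd]
        module
      rw [this]
      have h1 := norm_add_le ((1 - θ) • z.2) (θ • v)
      rw [norm_smul, norm_smul, Real.norm_of_nonneg (sub_nonneg.2 hθ.2),
        Real.norm_of_nonneg hθ.1] at h1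
      nlinarith [mul_le_mul_of_nonneg_left hz3.le (sub_nonneg.2 hθ.2),
        mul_le_mul_of_nonneg_left hvr.le hθ.1]
    have hinc := ofReal_abs_mollify_sub_le hk hkc (kernel_nonneg a b _) hf hG hw z (v - z.2) htest
    have e5 : z + (0, v - z.2) = (z.1, v) := by ext <;> simp
    rw [e5, ← hU, ← hV, abs_sub_comm] at hinc
    calc ENNReal.ofReal (ψ v * |U z - U (z.1, v)|)
        ≤ ENNReal.ofReal M * ENNReal.ofReal |U z - U (z.1, v)| := by
          rw [← ENNReal.ofReal_mul hM0]
          exact ENNReal.ofReal_le_ofReal (mul_le_mul_of_nonneg_right (hM v) (abs_nonneg _))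
      _ ≤ ENNReal.ofReal M * ∫⁻ θ in Icc (0 : ℝ) 1,
            ENNReal.ofReal (‖v - z.2‖ * V (z + θ • (0, v - z.2))) := by gcongr
      _ = ∫⁻ θ in Icc (0 : ℝ) 1, ENNReal.ofReal M *
            ENNReal.ofReal (‖v - z.2‖ * V (z + θ • (0, v - z.2))) := by
          rw [lintegral_const_mul' _ _ ENNReal.ofReal_ne_top]
      _ ≤ ∫⁻ θ in Icc (0 : ℝ) 1, Φ (z + θ • (0, v - z.2)) := by
          refine lintegral_mono fun θ => ?_
          simp only [hΦ]
          rw [← ENNReal.ofReal_mul hM0, mul_assoc]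
          refine ENNReal.ofReal_le_ofReal (mul_le_mul_of_nonneg_left ?_ hM0)
          exact mul_le_mul_of_nonneg_right hvz.le (hV0 _)
  -- Enlarging `S` to all of space-time gives access to translation invariance. Since the kernel has
  -- mass one, `V` has the same integral as the gradient norm.
  calc ∫⁻ z in S, ENNReal.ofReal |U z - ∫ v, ψ v * U (z.1, v)|
      ≤ ∫⁻ z in S, ∫⁻ h in B, ∫⁻ θ in Icc (0 : ℝ) 1, Φ (z + θ • (0, h)) :=
        setLIntegral_mono' hS hpt
    _ ≤ ∫⁻ z, ∫⁻ h in B, ∫⁻ θ in Icc (0 : ℝ) 1, Φ (z + θ • (0, h)) := setLIntegral_le_lintegral _ _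
    _ = volume B * ∫⁻ z, Φ z := lintegral_shift_eq hΦm B
    _ = _ := by
      have h1 : ∫⁻ z, Φ z = ENNReal.ofReal (M * (2 * r) * ∫ w in baseCylinder d 1, ‖g w‖) := by
        rw [← ofReal_integral_eq_lintegral_ofReal ((integrable_mollify hk hkc hG).const_mul _)
          (ae_of_all _ fun z => mul_nonneg (by positivity) (hV0 z)), integral_const_mul,
          integral_mollify hk hkc hG, integral_kernel, mul_one,
          integral_indicator (measurableSet_baseCylinder 1)]
      rw [h1, ← ofReal_measureReal (h := measure_ball_lt_top.ne),
        ← ENNReal.ofReal_mul measureReal_nonneg]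
      congr 1
      ring

end Slices

/-! ### Assembly on the two cylinders -/

lemma volume_baseCylinder_lt_top (r : ℝ) : volume (baseCylinder d r) < ⊤ := by
  rw [baseCylinder, Measure.volume_eq_prod, Measure.prod_prod]
  exact ENNReal.mul_lt_top measure_Ioc_lt_top measure_ball_lt_top

lemma volume_pastCylinder_lt_top (r : ℝ) : volume (pastCylinder d r) < ⊤ := by
  rw [pastCylinder, Measure.volume_eq_prod, Measure.prod_prod]
  exact ENNReal.mul_lt_top measure_Ioo_lt_top measure_ball_lt_top

lemma volume_pastCylinder_pos {r : ℝ} (hr : 0 < r) : 0 < volume (pastCylinder d r) := by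
  rw [pastCylinder, Measure.volume_eq_prod, Measure.prod_prod]
  refine ENNReal.mul_pos ?_ (Metric.measure_ball_pos _ _ hr).ne'
  rw [Real.volume_Ioo]
  exact (ENNReal.ofReal_pos.2 (by nlinarith)).ne'

/-- The parabolic Poincaré inequality for the mollified subsolution, in the form of a bound on the
mean oscillation. -/
lemma lintegral_lintegral_mollify_sub_le {Λ : ℝ} (hΛ : 0 < Λ)
    {A : SpaceTime d → Matrix (Fin d) (Fin d) ℝ} (hA : IsBoundedDiffusion d 1 Λ A)
    {f : SpaceTime d → ℝ} {g : SpaceTime d → EuclideanSpace ℝ (Fin d)}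
    (hsub : IsWeakSubsolution d 1 A f g) (hf : Integrable ((baseCylinder d 1).indicator f))
    (hg : IntegrableOn g (baseCylinder d 1)) {ψ : EuclideanSpace ℝ (Fin d) → ℝ}
    {L : NNReal} (hψ : LipschitzWith L ψ) (hψ0 : ∀ v, 0 ≤ ψ v) (hψ1 : ∫ v, ψ v = 1) {M : ℝ}
    (hM : ∀ v, ψ v ≤ M) (hψr : ∀ v, ψ v ≠ 0 → ‖v‖ < 1 / 20)
    {a : ContDiffBump (0 : ℝ)} {b : ContDiffBump (0 : EuclideanSpace ℝ (Fin d))} {ε : ℝ}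
    (ha : a.rOut = ε) (hb : b.rOut = ε) (hε : ε < 1 / 20) :
    ∫⁻ z in baseCylinder d (1 / 20), ∫⁻ w in pastCylinder d (1 / 20), ENNReal.ofReal
        (mollify (kernel a b (2 * ε)) ((baseCylinder d 1).indicator f) z
          - mollify (kernel a b (2 * ε)) ((baseCylinder d 1).indicator f) w)
      ≤ ENNReal.ofReal ((M * (2 * (1 / 20)) *
          volume.real (Metric.ball (0 : EuclideanSpace ℝ (Fin d)) (2 * (1 / 20))) *
            (volume.real (pastCylinder d (1 / 20)) + volume.real (baseCylinder d (1 / 20)))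
          + L * Λ * volume.real (pastCylinder d (1 / 20)) * volume.real (baseCylinder d (1 / 20)))
          * ∫ w in baseCylinder d 1, ‖g w‖) := by
  have hε0 : 0 < ε := ha ▸ a.rOut_pos
  have hM0 : 0 ≤ M := (hψ0 0).trans (hM 0)
  set U := mollify (kernel a b (2 * ε)) ((baseCylinder d 1).indicator f) with hU
  set F : ℝ → ℝ := fun t => ∫ v, ψ v * U (t, v) with hF
  set N := ∫ w in baseCylinder d 1, ‖g w‖ with hN
  have hN0 : 0 ≤ N := integral_nonneg fun _ => norm_nonneg _
  set β := volume.real (Metric.ball (0 : EuclideanSpace ℝ (Fin d)) (2 * (1 / 20)))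
  set m := M * (2 * (1 / 20)) * β * N with hm
  have hm0 : 0 ≤ m := by positivity
  set Qp := baseCylinder d (1 / 20) with hQp
  set Qm := pastCylinder d (1 / 20) with hQm
  have hp : ∫⁻ z in Qp, ENNReal.ofReal |U z - F z.1| ≤ ENNReal.ofReal m :=
    lintegral_abs_mollify_sub_integral_le hf hg hsub.weakGradient hψ.continuous hψ0 (by norm_num)
      hψr hψ1 hM ha hb (by linarith) (measurableSet_baseCylinder _) fun z hz => by
        obtain ⟨⟨h1, h2⟩, h3⟩ := hz
        exact ⟨by norm_num at h1; linarith, h2, by simpa using h3⟩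
  have hq : ∫⁻ z in Qm, ENNReal.ofReal |U z - F z.1| ≤ ENNReal.ofReal m :=
    lintegral_abs_mollify_sub_integral_le hf hg hsub.weakGradient hψ.continuous hψ0 (by norm_num)
      hψr hψ1 hM ha hb (by linarith) (measurableSet_pastCylinder _) fun z hz => by
        obtain ⟨⟨h1, h2⟩, h3⟩ := hz
        exact ⟨by norm_num at h1; linarith, by norm_num at h2; linarith, by simpa using h3⟩
  have hpt : ∀ z ∈ Qp, ∀ w ∈ Qm, ENNReal.ofReal (U z - U w) ≤
      (ENNReal.ofReal |U z - F z.1| + ENNReal.ofReal (L * Λ * N)) +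
        ENNReal.ofReal |U w - F w.1| := by
    rintro z ⟨⟨h1, h2⟩, -⟩ w ⟨⟨h3, h4⟩, -⟩
    -- The time gap orders the points: `w.1 < -2/400 < -1/400 < z.1`, the direction in which the
    -- one-sided bound applies.
    have hFF : F z.1 - F w.1 ≤ L * Λ * N :=
      integral_mul_mollify_sub_le hΛ hA hsub hf hg hψ hψ0 (fun v hv => (hψr v hv).le) ha hb
        (by linarith) (by norm_num at h1 h4; linarith) (by norm_num at h3; linarith) h2
    rw [← ENNReal.ofReal_add (abs_nonneg _) (by positivity),
      ← ENNReal.ofReal_add (by positivity) (abs_nonneg _)]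
    refine ENNReal.ofReal_le_ofReal ?_
    have h5 := le_abs_self (U z - F z.1)
    have h6 := neg_abs_le (U w - F w.1)
    linarith
  have hvp : volume Qp = ENNReal.ofReal (volume.real Qp) :=
    (ofReal_measureReal (h := (volume_baseCylinder_lt_top _).ne)).symm
  have hvm : volume Qm = ENNReal.ofReal (volume.real Qm) :=
    (ofReal_measureReal (h := (volume_pastCylinder_lt_top _).ne)).symm
  calc ∫⁻ z in Qp, ∫⁻ w in Qm, ENNReal.ofReal (U z - U w)
      ≤ ∫⁻ z in Qp, ((ENNReal.ofReal |U z - F z.1| * volume Qm +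
          (ENNReal.ofReal (L * Λ * N) * volume Qm + ENNReal.ofReal m))) := by
        refine setLIntegral_mono' (measurableSet_baseCylinder _) fun z hz => ?_
        refine (setLIntegral_mono' (measurableSet_pastCylinder _) (hpt z hz)).trans ?_
        rw [lintegral_add_left measurable_const, setLIntegral_const, add_mul, add_assoc]
        gcongr
    _ = (∫⁻ z in Qp, ENNReal.ofReal |U z - F z.1|) * volume Qm +
          (ENNReal.ofReal (L * Λ * N) * volume Qm + ENNReal.ofReal m) * volume Qp := by
        rw [lintegral_add_right _ measurable_const, setLIntegral_const,
          lintegral_mul_const' _ _ (volume_pastCylinder_lt_top _).ne]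
    _ ≤ ENNReal.ofReal m * volume Qm +
          (ENNReal.ofReal (L * Λ * N) * volume Qm + ENNReal.ofReal m) * volume Qp := by gcongr
    _ = _ := by
        have hx : 0 ≤ volume.real Qp := measureReal_nonneg
        have hy : 0 ≤ volume.real Qm := measureReal_nonneg
        rw [hvp, hvm, ← ENNReal.ofReal_mul (by positivity), ← ENNReal.ofReal_mul (by positivity),
          ← ENNReal.ofReal_add (by positivity) hm0, ← ENNReal.ofReal_mul (by positivity),
          ← ENNReal.ofReal_add (by positivity) (by positivity)]
        congr 1
        rw [hm]
        ring

/-- The parabolic Poincaré inequality. -/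
theorem parabolic_poincare (d : ℕ) (Λ : ℝ) (hΛ : 0 < Λ) :
    ∃ C : ℝ, 0 < C ∧
      ∀ (A : SpaceTime d → Matrix (Fin d) (Fin d) ℝ)
        (f : SpaceTime d → ℝ)
        (gradf : SpaceTime d → EuclideanSpace ℝ (Fin d)),
        IsBoundedDiffusion d 1 Λ A →
        (∀ᵐ z ∂(volume.restrict (baseCylinder d 1)), 0 ≤ f z) →
        IsWeakSubsolution d 1 A f gradf →
        ∫ z in baseCylinder d (1 / 20),
            max (f z - ⨍ w in pastCylinder d (1 / 20), f w) 0
          ≤ C * ∫ z in baseCylinder d 1, ‖gradf z‖ := by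
  let ψb : ContDiffBump (0 : EuclideanSpace ℝ (Fin d)) :=
    ⟨1 / 40, 1 / 20, by norm_num, by norm_num⟩
  have hψd : ContDiff ℝ 1 (ψb.normed volume) := ψb.contDiff_normed (n := 1)
  obtain ⟨L, hL⟩ := hψd.lipschitzWith_of_hasCompactSupport ψb.hasCompactSupport_normed one_ne_zero
  obtain ⟨M, hM⟩ := (ψb.hasCompactSupport_normed (μ := volume)).exists_bound_of_continuous
    ψb.continuous_normed
  have hM0 : 0 ≤ M := (norm_nonneg _).trans (hM 0)
  set p := volume.real (baseCylinder d (1 / 20))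
  set m := volume.real (pastCylinder d (1 / 20))
  set β := volume.real (Metric.ball (0 : EuclideanSpace ℝ (Fin d)) (2 * (1 / 20)))
  have hm : 0 < m := ENNReal.toReal_pos (volume_pastCylinder_pos (by norm_num)).ne'
    (volume_pastCylinder_lt_top _).ne
  have hp : 0 ≤ p := measureReal_nonneg
  have hβ : 0 ≤ β := measureReal_nonneg
  set K := M * (2 * (1 / 20)) * β * (m + p) + L * Λ * m * p with hK
  have hK0 : 0 ≤ K := by positivity
  -- The `+ 1` only makes the constant strictly positive.
  refine ⟨(K + 1) / m, by positivity, fun A f g hA _ hsub => ?_⟩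
  set N := ∫ z in baseCylinder d 1, ‖g z‖ with hN
  have hN0 : 0 ≤ N := integral_nonneg fun _ => norm_nonneg _
  have hfin : IsFiniteMeasure (volume.restrict (baseCylinder d 1)) :=
    ⟨by simpa using volume_baseCylinder_lt_top 1⟩
  have hfi : IntegrableOn f (baseCylinder d 1) := hsub.memLp.integrable one_le_two
  have hgi : IntegrableOn g (baseCylinder d 1) := hsub.memLp_grad.integrable one_le_two
  have hf : Integrable ((baseCylinder d 1).indicator f) :=
    (integrable_indicator_iff (measurableSet_baseCylinder 1)).2 hfi
  have hball := Metric.ball_subset_ball (x := (0 : EuclideanSpace ℝ (Fin d)))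
    (show (1 / 20 : ℝ) ≤ 1 by norm_num)
  have hsubp : baseCylinder d (1 / 20) ⊆ baseCylinder d 1 :=
    prod_mono (Ioc_subset_Ioc_left (by norm_num)) hball
  have hsubm : pastCylinder d (1 / 20) ⊆ baseCylinder d 1 :=
    prod_mono (fun t ht => ⟨by norm_num at ht ⊢; linarith [ht.1],
      by norm_num at ht; linarith [ht.2]⟩) hball
  -- Any positive null sequence below `1 / 20` would do.
  let ε : ℕ → ℝ := fun n => 1 / 21 / ((n : ℝ) + 1)
  have hε0 : ∀ n, 0 < ε n := fun n => by positivity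
  have hε1 : ∀ n, ε n < 1 / 20 := fun n => by
    have : ε n ≤ 1 / 21 := div_le_self (by norm_num) (by linarith [Nat.cast_nonneg (α := ℝ) n])
    linarith
  have hε : Filter.Tendsto ε Filter.atTop (nhdsWithin 0 (Ioi 0)) :=
    tendsto_nhdsWithin_iff.2 ⟨tendsto_const_div_atTop_nhds_zero_nat (1 / 21 : ℝ) |>.comp
      (Filter.tendsto_add_atTop_nat 1) |>.congr fun n => by simp [ε],
      Filter.Eventually.of_forall hε0⟩
  -- Inner radius `ε n / 2` keeps the ratio of radii equal to `2`, as the almost everywhere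
  -- convergence requires.
  let a : ℕ → ContDiffBump (0 : ℝ) := fun n =>
    ⟨ε n / 2, ε n, half_pos (hε0 n), half_lt_self (hε0 n)⟩
  let b : ℕ → ContDiffBump (0 : EuclideanSpace ℝ (Fin d)) := fun n =>
    ⟨ε n / 2, ε n, half_pos (hε0 n), half_lt_self (hε0 n)⟩
  have hlim := ae_tendsto_mollify_kernel hf hε (a := a) (b := b) (fun _ => rfl)
    (fun n => (mul_div_cancel₀ (ε n) two_ne_zero).ge) (fun _ => rfl)
    (fun n => (mul_div_cancel₀ (ε n) two_ne_zero).ge)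
  have hlimS : ∀ S ⊆ baseCylinder d 1, MeasurableSet S → ∀ᵐ z ∂(volume.restrict S),
      Filter.Tendsto (fun n => mollify (kernel (a n) (b n) (2 * ε n))
        ((baseCylinder d 1).indicator f) z) Filter.atTop (nhds (f z)) := by
    intro S hS hSm
    filter_upwards [ae_restrict_of_ae hlim, ae_restrict_mem hSm] with z hz hzS
    rwa [indicator_of_mem (hS hzS)] at hz
  have hosc := lintegral_lintegral_ofReal_sub_le_of_tendsto
    (fun n => (continuous_mollify (contDiff_kernel (a n) (b n) (2 * ε n))
      (hasCompactSupport_kernel _ _ _) hf).measurable)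
    (hlimS _ hsubp (measurableSet_baseCylinder _)) (hlimS _ hsubm (measurableSet_pastCylinder _))
    (fun n => lintegral_lintegral_mollify_sub_le hΛ hA hsub hf hgi hL
      (fun v => ψb.nonneg_normed v) ψb.integral_normed (fun v => (le_abs_self _).trans (hM v))
      (fun v hv => ContDiffBump.mem_ball_of_normed_ne_zero hv) (a := a n) (b := b n) rfl rfl
      (hε1 n))
  have hfinm : IsFiniteMeasure (volume.restrict (pastCylinder d (1 / 20))) :=
    ⟨by simpa using volume_pastCylinder_lt_top _⟩
  have hne : NeZero (volume.restrict (pastCylinder d (1 / 20))) :=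
    ⟨by simpa using (volume_pastCylinder_pos (by norm_num)).ne'⟩
  have hfinp : IsFiniteMeasure (volume.restrict (baseCylinder d (1 / 20))) :=
    ⟨by simpa using volume_baseCylinder_lt_top _⟩
  set c := ⨍ w in pastCylinder d (1 / 20), f w with hc
  have hint : Integrable (fun z => max (f z - c) 0)
      (volume.restrict (baseCylinder d (1 / 20))) :=
    ((hfi.mono_set hsubp).sub (integrable_const c)).pos_part
  set I := ∫ z in baseCylinder d (1 / 20), max (f z - c) 0 with hI
  have hvm : volume (pastCylinder d (1 / 20)) = ENNReal.ofReal m :=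
    (ofReal_measureReal (h := (volume_pastCylinder_lt_top _).ne)).symm
  -- Jensen in `w` for fixed `z`: the positive part at the mean, times the volume `m`, is below the
  -- integral of positive parts.
  have hfinal : ENNReal.ofReal (I * m) ≤ ENNReal.ofReal (K * N) := by
    refine le_trans ?_ hosc
    rw [ENNReal.ofReal_mul' hm.le, ← hvm, hI,
      ofReal_integral_eq_lintegral_ofReal hint (ae_of_all _ fun z => le_max_right _ _),
      ← lintegral_mul_const' _ _ (volume_pastCylinder_lt_top _).ne]
    refine lintegral_mono fun z => ?_
    have := ofReal_sub_average_mul_le (hfi.mono_set hsubm) (f z)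
    rw [Measure.restrict_apply_univ] at this
    have h0 : ENNReal.ofReal (max (f z - c) 0) = ENNReal.ofReal (f z - c) := by simp
    simpa only [h0] using this
  have h1 : I * m ≤ K * N := (ENNReal.ofReal_le_ofReal_iff (by positivity)).1 hfinal
  rw [div_mul_eq_mul_div, le_div_iff₀ hm]
  linarith

end ParabolicPoincare

end

theorem theorem3p7 (d : ℕ) (Λ : ℝ) (hΛ : 0 < Λ) :
    ∃ C : ℝ, 0 < C ∧
      ∀ (A : ParabolicPoincare.SpaceTime d → Matrix (Fin d) (Fin d) ℝ)
        (f : ParabolicPoincare.SpaceTime d → ℝ)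
        (gradf : ParabolicPoincare.SpaceTime d → EuclideanSpace ℝ (Fin d)),
        ParabolicPoincare.IsBoundedDiffusion d 1 Λ A →
        (∀ᵐ z ∂(volume.restrict (ParabolicPoincare.baseCylinder d 1)), 0 ≤ f z) →
        ParabolicPoincare.IsWeakSubsolution d 1 A f gradf →
        ∫ z in ParabolicPoincare.baseCylinder d (1 / 20),
            max (f z - ⨍ w in ParabolicPoincare.pastCylinder d (1 / 20), f w) 0
          ≤ C * ∫ z in ParabolicPoincare.baseCylinder d 1, ‖gradf z‖ :=
  ParabolicPoincare.parabolic_poincare d Λ hΛ
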